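/- Let $n \ge 0$ be an integer, and let $\mathcal{BT}_n$ be the boxed threshold arrangement in $\mathbb{R}^n$, that is, the arrangement of hyperplanes $$\{x_i + x_j = 0 \mid 1 \le i < j \le n\} \cup \{x_i = -\tfrac12,\ x_i = \tfrac12 \mid 1 \le i \le n\}.$$ Let $L(\mathcal{BT}_n)$ be its intersection poset, that is, the set of all nonempty intersections of hyperplanes of the arrangement (including $\mathbb{R}^n$, the empty intersection), ordered by reverse inclusion, and let $$\chi_{\mathcal{BT}_n}(t) = \sum_{x \in L(\mathcal{BT}_n)} \mu(\mathbb{R}^n, x)\, t^{\dim x}$$ be its characteristic polynomial, where $\mu$ is the Möbius function of $L(\mathcal{BT}_n)$. Then for every integer $j \ge 0$, the coefficient of $t^j$ in $\chi_{\mathcal{BT}_n}(t)$ equals $$\sum_{k=j}^{n} \bigl(S(n,k) + n\, S(n-1,k)\bigr)\, b(k,j).$$ Here $S(m,k)$ are the Stirling numbers of the second kind, with $S(0,0)=1$ (for $n=0$ the term $n\,S(n-1,k)$ is read as $0$), and $b(k,j)$ is the coefficient of $t^j$ in $(t-3)(t-5)\cdots(t-(2k+1))$, the empty product for $k=0$ being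 $1$. -/

import Mathlib

noncomputable section

open Polynomial

/-- The affine subspace `{x | a 0 * x 0 + ... + a (n-1) * x (n-1) = c}` of `ℝⁿ`. -/
def affineHyperplane {n : ℕ} (a : Fin n → ℝ) (c : ℝ) : AffineSubspace ℝ (Fin n → ℝ) where
  carrier := {x | ∑ i, a i * x i = c}
  smul_vsub_vadd_mem' := by
    intro r p q s hp hq hs
    simp only [Set.mem_ofPred_eq] at hp hq hs ⊢
    have h : ∑ i, a i * (r • (p -ᵥ q) +ᵥ s) i
        = r * (∑ i, a i * p i - ∑ i, a i * q i) + ∑ i, a i * s i := by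
      rw [← Finset.sum_sub_distrib, Finset.mul_sum, ← Finset.sum_add_distrib]
      refine Finset.sum_congr rfl fun i _ => ?_
      simp only [vsub_eq_sub, vadd_eq_add, Pi.add_apply, Pi.smul_apply, Pi.sub_apply, smul_eq_mul]
      ring
    rw [h, hp, hq, hs]
    ring

theorem mem_affineHyperplane {n : ℕ} (a : Fin n → ℝ) (c : ℝ) (x : Fin n → ℝ) :
    x ∈ affineHyperplane a c ↔ ∑ i, a i * x i = c := Iff.rfl

/-- A hyperplane arrangement in `ℝⁿ`: a finite set of affine hyperplanes. -/
structure HyperplaneArrangement (n : ℕ) where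
  hyperplanes : Set (AffineSubspace ℝ (Fin n → ℝ))
  finite : hyperplanes.Finite
  isHyperplane : ∀ H ∈ hyperplanes, ∃ a : Fin n → ℝ, a ≠ 0 ∧ ∃ c : ℝ, H = affineHyperplane a c

namespace HyperplaneArrangement

variable {n : ℕ} (A : HyperplaneArrangement n)

/-- The intersection poset of `A`: the nonempty intersections of subsets of `A` (the empty
intersection being the whole space `ℝⁿ`), ordered by reverse inclusion. -/
def Flat : Type :=
  {F : AffineSubspace ℝ (Fin n → ℝ) //
    (F : Set (Fin n → ℝ)).Nonempty ∧ ∃ S ⊆ A.hyperplanes, F = sInf S}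

namespace Flat

variable {A}

/-- The affine subspace underlying a flat. -/
def toAffineSubspace (F : A.Flat) : AffineSubspace ℝ (Fin n → ℝ) := F.1

/-- The dimension of a flat. -/
def dim (F : A.Flat) : ℕ := Module.finrank ℝ F.toAffineSubspace.direction

/-- Flats are ordered by reverse inclusion. -/
instance : PartialOrder A.Flat :=
  PartialOrder.lift (fun F => OrderDual.toDual F.toAffineSubspace) fun _ _ h => Subtype.ext h

theorem le_iff (F G : A.Flat) : F ≤ G ↔ G.toAffineSubspace ≤ F.toAffineSubspace := Iff.rfl

/-- The bottom element is the flat `ℝⁿ`. -/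
instance : OrderBot A.Flat where
  bot := ⟨⊤, ⟨0, trivial⟩, ∅, Set.empty_subset _, sInf_empty.symm⟩
  bot_le F := (le_iff _ F).2 le_top

instance : Finite A.Flat := by
  have : Finite A.hyperplanes.powerset := A.finite.finite_subsets
  refine Finite.of_surjective
    (fun S : {S : A.hyperplanes.powerset // (sInf S.1 : AffineSubspace ℝ (Fin n → ℝ)) ≠ ⊥} =>
      (⟨sInf S.1.1, (AffineSubspace.nonempty_iff_ne_bot _).2 S.2,
        S.1.1, S.1.2, rfl⟩ : A.Flat)) ?_
  rintro ⟨F, hF, S, hS, h⟩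
  refine ⟨⟨⟨S, hS⟩, ?_⟩, ?_⟩
  · rw [← h]
    exact (AffineSubspace.nonempty_iff_ne_bot _).1 hF
  · exact Subtype.ext h.symm

instance : Fintype A.Flat := Fintype.ofFinite _

instance : DecidableEq A.Flat := Classical.decEq _

instance : LocallyFiniteOrder A.Flat :=
  letI : DecidableLE A.Flat := Classical.decRel _
  letI : DecidableLT A.Flat := Classical.decRel _
  Fintype.toLocallyFiniteOrder

end Flat

/-- The characteristic polynomial `χ_A(t) = ∑ F, μ(ℝⁿ, F) t ^ dim F`, the sum being over the
intersection poset of `A` and `μ` being its Möbius function. -/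
def charPoly : ℤ[X] :=
  ∑ F : A.Flat, C (IncidenceAlgebra.mu ℤ (⊥ : A.Flat) F) * X ^ F.dim

end HyperplaneArrangement

/-- The boxed threshold arrangement in `ℝⁿ`, with hyperplanes `x i + x j = 0` for `i < j`,
and `x i = -1/2`, `x i = 1/2` for all `i`. -/
def boxedThreshold (n : ℕ) : HyperplaneArrangement n where
  hyperplanes :=
    {H | ∃ i j : Fin n, i < j ∧ H = affineHyperplane (Pi.single i 1 + Pi.single j 1) 0} ∪
    {H | ∃ i : Fin n, H = affineHyperplane (Pi.single i 1) (-1 / 2) ∨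
      H = affineHyperplane (Pi.single i 1) (1 / 2)}
  finite := by
    refine Set.Finite.union ?_ ?_
    · refine (Set.finite_range fun p : Fin n × Fin n =>
        affineHyperplane (Pi.single p.1 1 + Pi.single p.2 1 : Fin n → ℝ) 0).subset ?_
      rintro H ⟨i, j, _, rfl⟩
      exact ⟨(i, j), rfl⟩
    · refine ((Set.finite_range fun i : Fin n =>
        affineHyperplane (Pi.single i 1 : Fin n → ℝ) (-1 / 2)).union
        (Set.finite_range fun i : Fin n =>
        affineHyperplane (Pi.single i 1 : Fin n → ℝ) (1 / 2))).subset ?_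
      rintro H ⟨i, rfl | rfl⟩
      · exact Or.inl ⟨i, rfl⟩
      · exact Or.inr ⟨i, rfl⟩
  isHyperplane := by
    rintro H (⟨i, j, hij, rfl⟩ | ⟨i, rfl | rfl⟩)
    · refine ⟨_, fun h => ?_, _, rfl⟩
      have := congrFun h i
      simp [Pi.single_eq_of_ne hij.ne] at this
    · exact ⟨_, by simp, _, rfl⟩
    · exact ⟨_, by simp, _, rfl⟩

/-- `b(k, j)`: the coefficient of `t ^ j` in `(t - 3)(t - 5)⋯(t - (2k + 1))`. -/
def bCoeff (k j : ℕ) : ℤ :=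
  (∏ i ∈ Finset.Icc 1 k, (X - C (2 * (i : ℤ) + 1))).coeff j

end

/-!
The proof is a variant of the finite field method that stays inside `ℝⁿ`. Let `R` be a finite set of
real numbers, closed under negation and containing `0` and `1/2`. On a flat of the boxed threshold
arrangement, some of the coordinates are free and each of the others is one of the constants `0`,
`1/2`, `-1/2` or plus or minus a free coordinate (`IsSignedGraph.exists_of_subset`, by eliminating
one coordinate per hyperplane). Hence a flat of dimension `d` contains exactly `|R| ^ d` points of
the grid `Rⁿ` (`IsSignedGraph.card_filter_mem`). The flats through a point `x` form an interval
`[ℝⁿ, F_x]`, over which the Möbius function sums to `0` unless `F_x = ℝⁿ`; so the characteristic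
polynomial takes at `|R|` the number of grid points on none of the hyperplanes
(`HyperplaneArrangement.eval_charPoly_of_card`).

These points are the tuples with entries in `R \ {1/2, -1/2}` in which no two entries at different
positions sum to zero. Such a tuple has at most one zero entry. The remaining `|R| - 3` admissible
values come in pairs `±a`, of which a tuple uses at most one member; so a tuple of nonzero entries
with `k` distinct values arises from a partition of its index set into `k` blocks and one of
`(|R| - 3)(|R| - 5)⋯(|R| - (2k + 1))` choices of values. Together with the `n` possible positions of
a zero entry this gives the sum of the products with coefficients `S(n, k) + n S(n - 1, k)`
(`sum_nonopposingTuples_insert_zero`). With `R = {k / 2 | |k| ≤ m}` for all `m ≥ 1`, the two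
polynomials agree at infinitely many integers.
-/

open Polynomial

/-! ### Flats of the boxed threshold arrangement as signed graphs -/

/-- The function `f` on `ℝⁿ` is one of the constants `0`, `1/2`, `-1/2`, or it is plus or minus a
coordinate with index in `I`. -/
inductive IsSignedForm {n : ℕ} (I : Finset (Fin n)) : ((Fin n → ℝ) → ℝ) → Prop
  | const (c : ℝ) (hc : c = 0 ∨ c = 1 / 2 ∨ c = -1 / 2) : IsSignedForm I fun _ => c
  | coord (k : Fin n) (hk : k ∈ I) : IsSignedForm I fun x => x k
  | negCoord (k : Fin n) (hk : k ∈ I) : IsSignedForm I fun x => -x k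

namespace IsSignedForm

variable {n : ℕ} {I : Finset (Fin n)} {f g : (Fin n → ℝ) → ℝ}

theorem neg (hf : IsSignedForm I f) : IsSignedForm I fun x => -f x := by
  cases hf with
  | const c hc =>
    refine .const (-c) ?_
    rcases hc with rfl | rfl | rfl <;> norm_num
  | coord k hk => exact .negCoord k hk
  | negCoord k hk => simpa using IsSignedForm.coord k hk

theorem congr_on (hf : IsSignedForm I f) {x y : Fin n → ℝ} (h : ∀ i ∈ I, x i = y i) :
    f x = f y := by
  cases hf with
  | const c hc => rfl
  | coord k hk => exact h k hk
  | negCoord k hk => exact congrArg Neg.neg (h k hk)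

theorem mem_of_mem (hf : IsSignedForm I f) {Q : Set ℝ} (h0 : 0 ∈ Q) (h1 : 1 / 2 ∈ Q)
    (hneg : ∀ a ∈ Q, -a ∈ Q) {x : Fin n → ℝ} (hx : ∀ i ∈ I, x i ∈ Q) : f x ∈ Q := by
  cases hf with
  | const c hc =>
    rcases hc with rfl | rfl | rfl
    · exact h0
    · exact h1
    · simpa [neg_div] using hneg _ h1
  | coord k hk => exact hx k hk
  | negCoord k hk => exact hneg _ (hx k hk)

/-- Substituting a form in the remaining coordinates for the coordinate `m` gives a form. -/
theorem subst (hf : IsSignedForm I f) {m : Fin n} (hg : IsSignedForm (I.erase m) g) :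
    IsSignedForm (I.erase m) fun x => f (Function.update x m (g x)) := by
  cases hf with
  | const c hc => exact .const c hc
  | coord k hk =>
    by_cases h : k = m
    · subst h; simpa using hg
    · simpa [Function.update_of_ne h] using IsSignedForm.coord k (Finset.mem_erase.2 ⟨h, hk⟩)
  | negCoord k hk =>
    by_cases h : k = m
    · subst h; simpa using hg.neg
    · simpa [Function.update_of_ne h] using IsSignedForm.negCoord k (Finset.mem_erase.2 ⟨h, hk⟩)

/-- An equation between two forms holds everywhere, or nowhere, or can be solved for one of the
coordinates. -/
theorem eq_trichotomy (hf : IsSignedForm I f) (hg : IsSignedForm I g) :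
    (∀ x, f x = g x) ∨ (∀ x, f x ≠ g x) ∨
      ∃ m ∈ I, ∃ c, IsSignedForm (I.erase m) c ∧ ∀ x, f x = g x ↔ x m = c x := by
  have key : ∀ k ∈ I, ∀ {h}, IsSignedForm I h →
      (∀ x : Fin n → ℝ, x k = h x) ∨ (∀ x : Fin n → ℝ, x k ≠ h x) ∨
      ∃ m ∈ I, ∃ c, IsSignedForm (I.erase m) c ∧ ∀ x : Fin n → ℝ, x k = h x ↔ x m = c x := by
    intro k hk h hh
    cases hh with
    | const c hc => exact .inr (.inr ⟨k, hk, _, .const c hc, fun x => Iff.rfl⟩)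
    | coord l hl =>
      by_cases hkl : l = k
      · subst hkl; exact .inl fun x => rfl
      · exact .inr (.inr ⟨k, hk, _, .coord l (Finset.mem_erase.2 ⟨hkl, hl⟩), fun x => Iff.rfl⟩)
    | negCoord l hl =>
      by_cases hkl : l = k
      · subst hkl
        exact .inr (.inr ⟨l, hk, _, .const 0 (.inl rfl), fun x => self_eq_neg⟩)
      · exact .inr (.inr ⟨k, hk, _, .negCoord l (Finset.mem_erase.2 ⟨hkl, hl⟩), fun x => Iff.rfl⟩)
  cases hf with
  | coord k hk => exact key k hk hg
  | negCoord k hk =>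
    have := key k hk hg.neg
    simpa only [neg_eq_iff_eq_neg, ne_eq] using this
  | const c hc =>
    cases hg with
    | const d hd =>
      by_cases h : c = d
      · exact .inl fun _ => h
      · exact .inr (.inl fun _ => h)
    | coord k hk =>
      simpa only [eq_comm, ne_eq] using key k hk (.const c hc)
    | negCoord k hk =>
      have e (x : Fin n → ℝ) : c = -x k ↔ x k = -c := by rw [eq_comm, neg_eq_iff_eq_neg]
      simpa only [e, ne_eq] using key k hk (IsSignedForm.const c hc).neg

end IsSignedForm

/-- The affine subspace `F` is the graph of a function that expresses every coordinate as a signed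
form in the coordinates with index in `I`, which are free on `F`. -/
def IsSignedGraph {n : ℕ} (F : AffineSubspace ℝ (Fin n → ℝ)) (I : Finset (Fin n)) : Prop :=
  ∃ r : Fin n → (Fin n → ℝ) → ℝ, (∀ i, IsSignedForm I (r i)) ∧ (∀ i ∈ I, ∀ x, r i x = x i) ∧
    ∀ x, x ∈ F ↔ ∀ i, x i = r i x

namespace IsSignedGraph

variable {n : ℕ} {F : AffineSubspace ℝ (Fin n → ℝ)} {I : Finset (Fin n)}

theorem top : IsSignedGraph (⊤ : AffineSubspace ℝ (Fin n → ℝ)) Finset.univ :=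
  ⟨fun i x => x i, fun i => .coord i (Finset.mem_univ i), fun _ _ _ => rfl, by simp⟩

/-- On a signed graph, a hyperplane that amounts to solving for the free coordinate `m` in terms of
the other free coordinates removes `m` from the free coordinates. -/
theorem inf_of_solved (hF : IsSignedGraph F I) {H : AffineSubspace ℝ (Fin n → ℝ)} {m : Fin n}
    (hm : m ∈ I) {c : (Fin n → ℝ) → ℝ} (hc : IsSignedForm (I.erase m) c)
    (hH : ∀ x ∈ F, x ∈ H ↔ x m = c x) : IsSignedGraph (H ⊓ F) (I.erase m) := by
  obtain ⟨r, hr, hI, hmem⟩ := hF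
  refine ⟨fun i x => r i (Function.update x m (c x)), fun i => (hr i).subst hc, ?_, ?_⟩
  · intro i hi x
    beta_reduce
    rw [hI i (Finset.mem_of_mem_erase hi), Function.update_of_ne (Finset.ne_of_mem_erase hi)]
  · intro x
    rw [AffineSubspace.mem_inf_iff]
    constructor
    · rintro ⟨hxH, hxF⟩ i
      beta_reduce
      rw [← (hH x hxF).1 hxH, Function.update_eq_self]
      exact (hmem x).1 hxF i
    · intro h
      beta_reduce at h
      have hxm : x m = c x := by
        rw [h m, hI m hm, Function.update_self]
      have hxF : x ∈ F := by
        refine (hmem x).2 fun i => ?_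
        conv_lhs => rw [h i, ← hxm, Function.update_eq_self]
      exact ⟨(hH x hxF).2 hxm, hxF⟩

/-- A hyperplane cut out on `F` by an equation between two forms meets `F` in a signed graph,
unless it misses `F`. -/
theorem inf_of_form_eq (hF : IsSignedGraph F I) {H : AffineSubspace ℝ (Fin n → ℝ)}
    {f g : (Fin n → ℝ) → ℝ} (hf : IsSignedForm I f) (hg : IsSignedForm I g)
    (hH : ∀ x ∈ F, x ∈ H ↔ f x = g x) (hne : ((H ⊓ F : AffineSubspace ℝ (Fin n → ℝ)) :
      Set (Fin n → ℝ)).Nonempty) : ∃ J, IsSignedGraph (H ⊓ F) J := by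
  rcases hf.eq_trichotomy hg with h | h | ⟨m, hm, c, hc, h⟩
  · refine ⟨I, ?_⟩
    rwa [inf_eq_right.2 fun x hx => (hH x hx).2 (h x)]
  · obtain ⟨x, hxH, hxF⟩ := hne
    exact absurd ((hH x hxF).1 hxH) (h x)
  · exact ⟨_, hF.inf_of_solved hm hc fun x hx => (hH x hx).trans (h x)⟩

theorem inf_boxedThreshold (hF : IsSignedGraph F I) {H : AffineSubspace ℝ (Fin n → ℝ)}
    (hH : H ∈ (boxedThreshold n).hyperplanes) (hne : ((H ⊓ F : AffineSubspace ℝ (Fin n → ℝ)) :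
      Set (Fin n → ℝ)).Nonempty) : ∃ J, IsSignedGraph (H ⊓ F) J := by
  have hF' := hF
  obtain ⟨r, hr, -, hmem⟩ := hF'
  rcases hH with ⟨i, j, -, rfl⟩ | ⟨i, rfl | rfl⟩
  · refine hF.inf_of_form_eq (hr i) (hr j).neg (fun x hx => ?_) hne
    rw [← (hmem x).1 hx i, ← (hmem x).1 hx j, mem_affineHyperplane, ← add_eq_zero_iff_eq_neg]
    simp [add_mul, Finset.sum_add_distrib, Pi.single_apply]
  · refine hF.inf_of_form_eq (hr i) (.const (-1 / 2) (by simp)) (fun x hx => ?_) hne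
    rw [← (hmem x).1 hx i, mem_affineHyperplane]
    simp [Pi.single_apply]
  · refine hF.inf_of_form_eq (hr i) (.const (1 / 2) (by simp)) (fun x hx => ?_) hne
    rw [← (hmem x).1 hx i, mem_affineHyperplane]
    simp [Pi.single_apply]

/-- Every nonempty intersection of hyperplanes of the boxed threshold arrangement is a signed graph. -/
theorem exists_of_subset {S : Set (AffineSubspace ℝ (Fin n → ℝ))}
    (hS : S ⊆ (boxedThreshold n).hyperplanes)
    (hne : ((sInf S : AffineSubspace ℝ (Fin n → ℝ)) : Set (Fin n → ℝ)).Nonempty) :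
    ∃ J, IsSignedGraph (sInf S) J := by
  have hfin : S.Finite := (boxedThreshold n).finite.subset hS
  induction S, hfin using Set.Finite.induction_on with
  | empty => exact ⟨_, by simpa using top⟩
  | @insert H S _ _ ih =>
    rw [sInf_insert] at hne ⊢
    obtain ⟨J, hJ⟩ := ih ((Set.subset_insert _ _).trans hS)
      (hne.mono (show (H ⊓ sInf S : AffineSubspace ℝ (Fin n → ℝ)) ≤ sInf S from inf_le_right))
    exact hJ.inf_boxedThreshold (hS (Set.mem_insert _ _)) hne

/-- The point of `F` with prescribed values of the free coordinates. -/
theorem exists_extension (hF : IsSignedGraph F I) (y : I → ℝ) :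
    ∃ x ∈ F, ∀ i : I, x i = y i := by
  obtain ⟨r, hr, hI, hmem⟩ := hF
  set z : Fin n → ℝ := fun i => if h : i ∈ I then y ⟨i, h⟩ else 0 with hz
  have hzI : ∀ i : I, r i z = y i := fun i => by rw [hI i i.2, hz]; simp
  refine ⟨fun i => r i z, (hmem _).2 fun i => (hr i).congr_on fun k hk => (hI k hk z).symm, hzI⟩

theorem ext_on (hF : IsSignedGraph F I) {x y : Fin n → ℝ} (hx : x ∈ F) (hy : y ∈ F)
    (h : ∀ i ∈ I, x i = y i) : x = y := by
  obtain ⟨r, hr, -, hmem⟩ := hF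
  funext i
  rw [(hmem x).1 hx i, (hmem y).1 hy i, (hr i).congr_on h]

theorem finrank_direction (hF : IsSignedGraph F I) :
    Module.finrank ℝ F.direction = I.card := by
  obtain ⟨x₀, hx₀, hx₀I⟩ := hF.exists_extension 0
  let φ : F.direction →ₗ[ℝ] (I → ℝ) :=
    (LinearMap.funLeft ℝ ℝ (Subtype.val : I → Fin n)).comp F.direction.subtype
  have hφ : Function.Bijective φ := by
    constructor
    · rw [injective_iff_map_eq_zero]
      rintro ⟨v, hv⟩ h
      have hvF := AffineSubspace.vadd_mem_of_mem_direction hv hx₀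
      have := hF.ext_on hvF hx₀ fun i hi => by
        have h' := congrFun h ⟨i, hi⟩
        simpa [φ, LinearMap.funLeft] using h'
      ext1
      simpa using this
    · intro y
      obtain ⟨x, hx, hxy⟩ := hF.exists_extension y
      refine ⟨⟨x -ᵥ x₀, AffineSubspace.vsub_mem_direction hx hx₀⟩, ?_⟩
      funext i
      simp [φ, LinearMap.funLeft, hxy i, hx₀I i]
  rw [(LinearEquiv.ofBijective φ hφ).finrank_eq]
  simp

open Classical in
/-- A signed graph has as many points with all coordinates in a symmetric set `Q` containing `0` and
`1/2` as its free coordinates allow. -/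
theorem card_filter_mem (hF : IsSignedGraph F I) {Q : Finset ℝ} (h0 : 0 ∈ Q) (h1 : 1 / 2 ∈ Q)
    (hneg : ∀ a ∈ Q, -a ∈ Q) :
    ((Fintype.piFinset fun _ : Fin n => Q).filter (· ∈ F)).card =
      Q.card ^ Module.finrank ℝ F.direction := by
  rw [hF.finrank_direction]
  have : Q.card ^ I.card = (Fintype.piFinset fun _ : I => Q).card := by simp
  rw [this]
  refine Finset.card_bij (fun x _ i => x i) ?_ ?_ ?_
  · intro x hx
    simp only [Finset.mem_filter, Fintype.mem_piFinset] at hx ⊢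
    exact fun i => hx.1 i
  · intro x hx y hy h
    exact hF.ext_on (Finset.mem_filter.1 hx).2 (Finset.mem_filter.1 hy).2
      fun i hi => congrFun h ⟨i, hi⟩
  · intro y hy
    obtain ⟨x, hx, hxy⟩ := hF.exists_extension y
    refine ⟨x, ?_, funext hxy⟩
    simp only [Finset.mem_filter, Fintype.mem_piFinset] at hy ⊢
    refine ⟨fun i => ?_, hx⟩
    obtain ⟨r, hr, -, hmem⟩ := hF
    rw [(hmem x).1 hx i]
    exact (hr i).mem_of_mem (Q := (Q : Set ℝ)) h0 h1 hneg
      fun k hk => by rw [hxy ⟨k, hk⟩]; exact hy ⟨k, hk⟩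

end IsSignedGraph

/-! ### Möbius inversion over the intersection poset -/

namespace HyperplaneArrangement

variable {n : ℕ} (A : HyperplaneArrangement n)

/-- The smallest flat of `A` through the point `x`. -/
def flatThrough (x : Fin n → ℝ) : A.Flat :=
  ⟨sInf {H ∈ A.hyperplanes | x ∈ H}, ⟨x, (AffineSubspace.mem_sInf_iff _ _).2 fun _ h => h.2⟩,
    _, fun _ h => h.1, rfl⟩

/-- The flats containing `x` form the interval `[⊥, A.flatThrough x]`. -/
theorem le_flatThrough_iff (F : A.Flat) (x : Fin n → ℝ) :
    F ≤ A.flatThrough x ↔ x ∈ F.toAffineSubspace := by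
  rw [Flat.le_iff]
  constructor
  · intro h
    exact h ((AffineSubspace.mem_sInf_iff x {H ∈ A.hyperplanes | x ∈ H}).2 fun _ h => h.2)
  · intro hx
    obtain ⟨F, hF, S, hS, rfl⟩ := F
    have hx' : ∀ H ∈ S, x ∈ H := (AffineSubspace.mem_sInf_iff x S).1 hx
    exact sInf_le_sInf fun H hH => ⟨hS hH, hx' H hH⟩

theorem bot_eq_flatThrough_iff (x : Fin n → ℝ) :
    ⊥ = A.flatThrough x ↔ ∀ H ∈ A.hyperplanes, x ∉ H := by
  constructor
  · intro h H hH hx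
    let F : A.Flat := ⟨H, ⟨x, hx⟩, {H}, by simpa using hH, by simp⟩
    have h2 : (⊤ : AffineSubspace ℝ (Fin n → ℝ)) ≤ H :=
      (Flat.le_iff F ⊥).1 (h ▸ (A.le_flatThrough_iff F x).2 hx)
    obtain ⟨a, ha, c, rfl⟩ := A.isHyperplane H hH
    obtain ⟨i, hi⟩ := Function.ne_iff.1 ha
    have e0 := (mem_affineHyperplane a c 0).1 (h2 trivial)
    have e1 := (mem_affineHyperplane a c (Pi.single i 1)).1 (h2 trivial)
    simp [Pi.single_apply] at e0 e1 hi
    exact hi (e1.trans e0.symm)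
  · intro h
    refine le_antisymm bot_le ((Flat.le_iff _ _).2 ?_)
    have : {H ∈ A.hyperplanes | x ∈ H} = ∅ := by
      ext H; simpa using h H
    change (⊤ : AffineSubspace ℝ (Fin n → ℝ)) ≤ sInf {H ∈ A.hyperplanes | x ∈ H}
    rw [this, sInf_empty]

open Classical in
/-- If a finite set `P` of points meets every flat `F` of `A` in `q ^ dim F` points, then the
characteristic polynomial of `A` takes at `q` the number of points of `P` off the hyperplanes of
`A`. This is Möbius inversion over the intersection poset. -/
theorem eval_charPoly_of_card (P : Finset (Fin n → ℝ)) (q : ℤ)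
    (h : ∀ F : A.Flat, ((P.filter (· ∈ F.toAffineSubspace)).card : ℤ) = q ^ F.dim) :
    A.charPoly.eval q = (P.filter fun x => ∀ H ∈ A.hyperplanes, x ∉ H).card := by
  have key (x : Fin n → ℝ) : ∑ F : A.Flat with x ∈ F.toAffineSubspace,
      IncidenceAlgebra.mu ℤ (⊥ : A.Flat) F = if ∀ H ∈ A.hyperplanes, x ∉ H then 1 else 0 := by
    have hI : (Finset.univ.filter fun F : A.Flat => x ∈ F.toAffineSubspace) =
        Finset.Icc ⊥ (A.flatThrough x) := by
      ext F; simp [A.le_flatThrough_iff]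
    rw [hI]
    simp only [← A.bot_eq_flatThrough_iff]
    convert IncidenceAlgebra.sum_Icc_mu_right (𝕜 := ℤ) (⊥ : A.Flat) (A.flatThrough x)
  rw [charPoly, eval_finsetSum, Finset.card_filter]
  push_cast
  simp_rw [← key, Finset.sum_filter, eval_mul, eval_pow, eval_C, eval_X, ← h, Finset.card_filter]
  push_cast
  simp_rw [Finset.mul_sum, mul_ite, mul_one, mul_zero]
  exact Finset.sum_comm

end HyperplaneArrangement

/-! ### Counting tuples without opposite entries -/

/-- The `n`-tuples of elements of `Q` in which no two entries at different
positions sum to zero. -/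
noncomputable def nonopposingTuples (Q : Finset ℝ) (n : ℕ) : Finset (Fin n → ℝ) :=
  (Fintype.piFinset fun _ => Q).filter fun x => ∀ i j, i < j → x i + x j ≠ 0

theorem mem_nonopposingTuples {Q : Finset ℝ} {n : ℕ} {x : Fin n → ℝ} :
    x ∈ nonopposingTuples Q n ↔ (∀ i, x i ∈ Q) ∧ ∀ i j, i < j → x i + x j ≠ 0 := by
  simp [nonopposingTuples, Fintype.mem_piFinset]

theorem cons_mem_nonopposingTuples {Q : Finset ℝ} {n : ℕ} {a : ℝ} {x : Fin n → ℝ} :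
    (Fin.cons a x : Fin (n + 1) → ℝ) ∈ nonopposingTuples Q (n + 1) ↔
      x ∈ nonopposingTuples Q n ∧ a ∈ Q ∧ ∀ i, a + x i ≠ 0 := by
  simp only [mem_nonopposingTuples, Fin.forall_fin_succ, Fin.cons_zero, Fin.cons_succ,
    Fin.succ_lt_succ_iff, Fin.succ_pos, Fin.not_lt_zero, false_imp_iff, true_imp_iff,
    true_and]
  tauto

theorem sum_nonopposingTuples_succ (Q : Finset ℝ) (n : ℕ) (g : (Fin (n + 1) → ℝ) → ℤ) :
    ∑ x ∈ nonopposingTuples Q (n + 1), g x =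
      ∑ x ∈ nonopposingTuples Q n, ∑ a ∈ Q with ∀ i, a + x i ≠ 0, g (Fin.cons a x) := by
  rw [Finset.sum_sigma']
  refine Finset.sum_nbij' (fun x => ⟨Fin.tail x, x 0⟩) (fun p => Fin.cons p.2 p.1) ?_ ?_ ?_ ?_ ?_
  · intro x hx
    rw [← Fin.cons_self_tail x, cons_mem_nonopposingTuples] at hx
    simpa using hx
  · rintro ⟨x, a⟩ h
    rw [cons_mem_nonopposingTuples]
    simpa using h
  · intro x _; exact Fin.cons_self_tail x
  · rintro ⟨x, a⟩ _; simp
  · intro x _; simp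

/-- The number of distinct nonzero entries of a tuple. -/
noncomputable def numNonzeroValues {n : ℕ} (x : Fin n → ℝ) : ℕ := ((Finset.univ.image x).erase 0).card

theorem numNonzeroValues_cons {n : ℕ} (a : ℝ) (x : Fin n → ℝ) :
    numNonzeroValues (Fin.cons a x : Fin (n + 1) → ℝ) =
      if a = 0 ∨ a ∈ Finset.univ.image x then numNonzeroValues x else numNonzeroValues x + 1 := by
  have h : Finset.univ.image (Fin.cons a x : Fin (n + 1) → ℝ) =
      insert a (Finset.univ.image x) := by
    ext b
    simp [Fin.exists_fin_succ, eq_comm]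
  unfold numNonzeroValues
  rw [h]
  split_ifs with h'
  · rcases h' with rfl | h'
    · rw [Finset.erase_insert_eq_erase]
    · rw [Finset.insert_eq_self.2 h']
  · rw [not_or] at h'
    rw [Finset.erase_insert_of_ne h'.1, Finset.card_insert_of_notMem]
    exact fun h => h'.2 (Finset.mem_of_mem_erase h)

/-- The entries of a tuple `x` with `c` distinct nonzero values use up `c` pairs `±a`; so an
admissible nonzero entry put in front either repeats one of these `c` values or is one of the
remaining `Q.card - 2 * c` elements of `Q`. -/
theorem sum_cons_nonzero {Q : Finset ℝ} (h0 : 0 ∉ Q) (hneg : ∀ a ∈ Q, -a ∈ Q) {n : ℕ}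
    {x : Fin n → ℝ} (hx : x ∈ nonopposingTuples (insert 0 Q) n) (w : ℕ → ℤ) :
    ∑ a ∈ Q with ∀ i, a + x i ≠ 0, w (numNonzeroValues (Fin.cons a x : Fin (n + 1) → ℝ)) =
      numNonzeroValues x * w (numNonzeroValues x) +
        (Q.card - 2 * numNonzeroValues x) * w (numNonzeroValues x + 1) := by
  obtain ⟨hxQ, hx2⟩ := mem_nonopposingTuples.1 hx
  have hx3 : ∀ i j, x i ≠ 0 → x i + x j ≠ 0 := by
    intro i j hi h
    rcases lt_trichotomy i j with hij | rfl | hij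
    · exact hx2 i j hij h
    · exact hi (by linarith)
    · exact hx2 j i hij (by linarith)
  set B := (Finset.univ.image x).erase 0 with hB
  have hBQ : B ⊆ Q := by
    intro b hb
    simp only [hB, Finset.mem_erase, Finset.mem_image, Finset.mem_univ, true_and] at hb
    obtain ⟨hb0, i, rfl⟩ := hb
    exact (Finset.mem_insert.1 (hxQ i)).resolve_left hb0
  have hQ0 : ∀ a ∈ Q, a ≠ 0 := fun a ha h => h0 (h ▸ ha)
  set N := B.image Neg.neg with hN
  have hNQ : N ⊆ Q := by
    intro b hb
    obtain ⟨c, hc, rfl⟩ := Finset.mem_image.1 hb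
    exact hneg c (hBQ hc)
  have hmemB : ∀ a ∈ Q, a ∈ B ↔ a ∈ Finset.univ.image x := fun a ha => by
    simp [hB, hQ0 a ha]
  have hmemN : ∀ a ∈ Q, a ∉ N ↔ ∀ i, a + x i ≠ 0 := by
    intro a ha
    simp only [hN, hB, Finset.mem_image, Finset.mem_erase, Finset.mem_univ, true_and, not_exists,
      not_and]
    constructor
    · intro h i hi
      refine h (x i) ⟨fun h' => hQ0 a ha (by linarith), i, rfl⟩ (by linarith)
    · rintro h _ ⟨-, i, rfl⟩ hi
      exact h i (by linarith)
  have hdisj : Disjoint B N := by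
    rw [Finset.disjoint_left]
    intro a haB haN
    obtain ⟨ha0, i, -, rfl⟩ : a ≠ 0 ∧ ∃ i, i ∈ Finset.univ ∧ x i = a := by
      simpa [hB] using haB
    refine (hmemN _ (hBQ haB)).2 (fun j => hx3 i j ha0) haN
  have hcardN : N.card = B.card := Finset.card_image_of_injective _ neg_injective
  have hsplit : (Q.filter fun a => ∀ i, a + x i ≠ 0) = B ∪ (Q \ (B ∪ N)) := by
    ext a
    simp only [Finset.mem_filter, Finset.mem_union, Finset.mem_sdiff]
    constructor
    · rintro ⟨ha, h⟩
      have := (hmemN a ha).2 h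
      tauto
    · rintro (ha | ⟨ha, h⟩)
      · exact ⟨hBQ ha, (hmemN a (hBQ ha)).1 (Finset.disjoint_left.1 hdisj ha)⟩
      · exact ⟨ha, (hmemN a ha).1 fun h' => h (.inr h')⟩
  have hcard : ((Q \ (B ∪ N)).card : ℤ) = Q.card - 2 * B.card := by
    rw [Finset.cast_card_sdiff (Finset.union_subset hBQ hNQ), Finset.card_union_of_disjoint hdisj,
      hcardN]
    push_cast
    ring
  rw [hsplit, Finset.sum_union (Finset.disjoint_left.2 fun a ha h =>
    (Finset.mem_sdiff.1 h).2 (Finset.mem_union_left _ ha))]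
  congr 1
  · rw [Finset.sum_congr rfl (g := fun _ => w (numNonzeroValues x)) fun a ha => by
      rw [numNonzeroValues_cons, if_pos (.inr ((hmemB a (hBQ ha)).1 ha))]]
    simp [numNonzeroValues, ← hB]
  · rw [Finset.sum_congr rfl (g := fun _ => w (numNonzeroValues x + 1)) fun a ha => by
      obtain ⟨haQ, haB⟩ := Finset.mem_sdiff.1 ha
      rw [numNonzeroValues_cons, if_neg]
      rintro (h | h)
      · exact hQ0 a haQ h
      · exact haB (Finset.mem_union_left _ ((hmemB a haQ).2 h))]
    rw [Finset.sum_const, nsmul_eq_mul, hcard]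
    rfl

/-- The recurrence of the Stirling numbers of the second kind, summed against a sequence whose
`k`-th term is weighted by the product `∏ (q - 2 * i)`, `i < k`. -/
theorem sum_stirlingSecond_succ (q : ℤ) (n : ℕ) (w : ℕ → ℤ) :
    ∑ k ∈ Finset.range (n + 1), (Nat.stirlingSecond n k : ℤ) * (∏ i ∈ Finset.range k, (q - 2 * i)) *
        (k * w k + (q - 2 * k) * w (k + 1)) =
      ∑ k ∈ Finset.range (n + 2), (Nat.stirlingSecond (n + 1) k : ℤ) *
        (∏ i ∈ Finset.range k, (q - 2 * i)) * w k := by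
  rw [Finset.sum_range_succ' _ (n + 1)]
  simp only [Nat.stirlingSecond_succ_succ, Nat.stirlingSecond_succ_zero, Nat.cast_zero, zero_mul,
    add_zero, Nat.cast_add, Nat.cast_mul, add_mul, mul_add, Finset.sum_add_distrib]
  congr 1
  · have h := Finset.sum_range_succ' (fun k => (Nat.stirlingSecond n k : ℤ) *
      (∏ i ∈ Finset.range k, (q - 2 * i)) * (k * w k)) (n + 1)
    rw [Finset.sum_range_succ] at h
    simp only [Nat.stirlingSecond_eq_zero_of_lt (Nat.lt_succ_self n), Nat.cast_zero, zero_mul,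
      mul_zero, add_zero] at h
    rw [h, ← Finset.sum_add_distrib]
    refine Finset.sum_congr rfl fun k _ => ?_
    push_cast
    ring
  · refine Finset.sum_congr rfl fun k _ => ?_
    rw [Finset.prod_range_succ]
    ring

/-- If `Q` is symmetric and `0 ∉ Q`, then `S(n, k) * ∏ (Q.card - 2 * i)`, `i < k`, of the nonopposing
tuples have `k` distinct entries. The count is stated against an arbitrary weight `w`, which lets
the induction on `n` pass from `w` to a modified weight. -/
theorem sum_nonopposingTuples {Q : Finset ℝ} (h0 : 0 ∉ Q) (hneg : ∀ a ∈ Q, -a ∈ Q) (n : ℕ)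
    (w : ℕ → ℤ) :
    ∑ x ∈ nonopposingTuples Q n, w (numNonzeroValues x) =
      ∑ k ∈ Finset.range (n + 1), (Nat.stirlingSecond n k : ℤ) *
        (∏ i ∈ Finset.range k, ((Q.card : ℤ) - 2 * i)) * w k := by
  induction n generalizing w with
  | zero => simp [nonopposingTuples, numNonzeroValues]
  | succ n ih =>
    rw [sum_nonopposingTuples_succ, ← sum_stirlingSecond_succ, ← ih fun k =>
      k * w k + (Q.card - 2 * k) * w (k + 1)]
    refine Finset.sum_congr rfl fun x hx => sum_cons_nonzero h0 hneg ?_ w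
    obtain ⟨h1, h2⟩ := mem_nonopposingTuples.1 hx
    exact mem_nonopposingTuples.2 ⟨fun i => Finset.mem_insert_of_mem (h1 i), h2⟩

/-- The count of `sum_nonopposingTuples` when zero entries are allowed as well. A nonopposing tuple
has at most one of them, in any of `n` positions; this is the source of `n * S(n - 1, k)`. -/
theorem sum_nonopposingTuples_insert_zero {Q : Finset ℝ} (h0 : 0 ∉ Q) (hneg : ∀ a ∈ Q, -a ∈ Q)
    (n : ℕ) (w : ℕ → ℤ) :
    ∑ x ∈ nonopposingTuples (insert 0 Q) n, w (numNonzeroValues x) =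
      ∑ k ∈ Finset.range (n + 1), ((Nat.stirlingSecond n k : ℤ) +
        n * (Nat.stirlingSecond (n - 1) k : ℤ)) *
        (∏ i ∈ Finset.range k, ((Q.card : ℤ) - 2 * i)) * w k := by
  induction n generalizing w with
  | zero => simp [nonopposingTuples, numNonzeroValues]
  | succ n ih =>
    have hzero : (nonopposingTuples (insert 0 Q) n).filter (fun x => ∀ i, 0 + x i ≠ 0) =
        nonopposingTuples Q n := by
      ext x
      simp only [Finset.mem_filter, mem_nonopposingTuples, zero_add, Finset.mem_insert]
      constructor
      · rintro ⟨⟨h1, h2⟩, h3⟩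
        exact ⟨fun i => (h1 i).resolve_left (h3 i), h2⟩
      · rintro ⟨h1, h2⟩
        exact ⟨⟨fun i => .inr (h1 i), h2⟩, fun i h => h0 (h ▸ h1 i)⟩
    -- A zero entry in front requires a tail without zeros.
    have hstep : ∑ x ∈ nonopposingTuples (insert 0 Q) (n + 1), w (numNonzeroValues x) =
        ∑ x ∈ nonopposingTuples Q n, w (numNonzeroValues x) +
        ∑ x ∈ nonopposingTuples (insert 0 Q) n, (numNonzeroValues x * w (numNonzeroValues x) +
          (Q.card - 2 * numNonzeroValues x) * w (numNonzeroValues x + 1)) := by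
      rw [sum_nonopposingTuples_succ, ← hzero, Finset.sum_filter, ← Finset.sum_add_distrib]
      refine Finset.sum_congr rfl fun x hx => ?_
      have hc : numNonzeroValues (Fin.cons 0 x : Fin (n + 1) → ℝ) = numNonzeroValues x := by
        simp [numNonzeroValues_cons]
      rw [Finset.sum_filter, Finset.sum_insert h0, ← Finset.sum_filter,
        sum_cons_nonzero h0 hneg hx, hc]
    rw [hstep, sum_nonopposingTuples h0 hneg, ih fun k =>
      k * w k + (Q.card - 2 * k) * w (k + 1)]
    simp only [add_mul, Finset.sum_add_distrib, Nat.add_sub_cancel]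
    rw [sum_stirlingSecond_succ]
    have hprev : ∑ k ∈ Finset.range (n + 1), (n : ℤ) * (Nat.stirlingSecond (n - 1) k : ℤ) *
        (∏ i ∈ Finset.range k, ((Q.card : ℤ) - 2 * i)) *
        (k * w k + (Q.card - 2 * k) * w (k + 1)) =
        n * ∑ k ∈ Finset.range (n + 1), (Nat.stirlingSecond n k : ℤ) *
        (∏ i ∈ Finset.range k, ((Q.card : ℤ) - 2 * i)) * w k := by
      cases n with
      | zero => simp
      | succ m =>
        rw [Nat.add_sub_cancel, ← sum_stirlingSecond_succ, Finset.sum_range_succ,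
          Nat.stirlingSecond_eq_zero_of_lt (Nat.lt_succ_self m), Finset.mul_sum]
        simp only [Nat.cast_zero, mul_zero, zero_mul, add_zero, mul_assoc]
    rw [hprev, Finset.sum_range_succ _ (n + 1), Finset.sum_range_succ _ (n + 1),
      Nat.stirlingSecond_eq_zero_of_lt (Nat.lt_succ_self n), Finset.mul_sum]
    push_cast
    simp only [add_mul, one_mul, Finset.sum_add_distrib, mul_zero, zero_mul, add_zero, mul_assoc]
    ring

/-! ### The characteristic polynomial of the boxed threshold arrangement -/

/-- The numbers `k / 2` with `k` an integer, `2 ≤ |k| ≤ m`. -/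
noncomputable def halfIntegers (m : ℕ) : Finset ℝ :=
  (Finset.Icc (-(m : ℤ)) m \ {0, 1, -1}).image fun k : ℤ => (k : ℝ) / 2

theorem mem_halfIntegers {m : ℕ} {a : ℝ} :
    a ∈ halfIntegers m ↔
      ∃ k : ℤ, (-(m : ℤ) ≤ k ∧ k ≤ m) ∧ (k ≠ 0 ∧ k ≠ 1 ∧ k ≠ -1) ∧ (k : ℝ) / 2 = a := by
  simp [halfIntegers, and_assoc]

theorem zero_notMem_halfIntegers (m : ℕ) : 0 ∉ halfIntegers m := by
  rw [mem_halfIntegers]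
  rintro ⟨k, -, hk, h⟩
  exact hk.1 (by simpa using h)

theorem neg_mem_halfIntegers (m : ℕ) : ∀ a ∈ halfIntegers m, -a ∈ halfIntegers m := by
  intro a ha
  obtain ⟨k, hk, hk', rfl⟩ := mem_halfIntegers.1 ha
  exact mem_halfIntegers.2 ⟨-k, by omega, by omega, by push_cast; ring⟩

theorem half_notMem_halfIntegers (m : ℕ) : 1 / 2 ∉ halfIntegers m := by
  rw [mem_halfIntegers]
  rintro ⟨k, -, hk, h⟩
  refine hk.2.1 ?_
  have : (k : ℝ) = 1 := by linarith
  exact_mod_cast this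

theorem neg_half_notMem_halfIntegers (m : ℕ) : -1 / 2 ∉ halfIntegers m := fun h =>
  half_notMem_halfIntegers m (by simpa [neg_div] using neg_mem_halfIntegers m _ h)

theorem card_halfIntegers {m : ℕ} (hm : 1 ≤ m) : ((halfIntegers m).card : ℤ) = 2 * m - 2 := by
  rw [halfIntegers, Finset.card_image_of_injective _ fun a b h => by
    exact_mod_cast (div_left_inj' (two_ne_zero (α := ℝ))).1 h, Finset.cast_card_sdiff]
  · have h : ({0, 1, -1} : Finset ℤ).card = 3 := rfl
    rw [h, Int.card_Icc, Int.toNat_of_nonneg (by omega)]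
    push_cast
    ring
  · intro k hk
    simp only [Finset.mem_insert, Finset.mem_singleton] at hk
    rw [Finset.mem_Icc]
    omega

open Classical in
/-- The grid points off the boxed threshold arrangement, for a grid of side
`Q ∪ {0, 1/2, -1/2}`. -/
theorem filter_piFinset_boxedThreshold {Q : Finset ℝ} (h1 : 1 / 2 ∉ Q) (h2 : -1 / 2 ∉ Q) (n : ℕ) :
    ((Fintype.piFinset fun _ : Fin n => insert (1 / 2) (insert (-1 / 2) (insert 0 Q))).filter
      fun x => ∀ H ∈ (boxedThreshold n).hyperplanes, x ∉ H) =
      nonopposingTuples (insert 0 Q) n := by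
  ext x
  have hH : (∀ H ∈ (boxedThreshold n).hyperplanes, x ∉ H) ↔
      (∀ i j, i < j → x i + x j ≠ 0) ∧ ∀ i, x i ≠ -1 / 2 ∧ x i ≠ 1 / 2 := by
    have e1 (i j : Fin n) : x ∈ affineHyperplane (Pi.single i 1 + Pi.single j 1) 0 ↔
        x i + x j = 0 := by
      rw [mem_affineHyperplane]
      simp [add_mul, Finset.sum_add_distrib, Pi.single_apply]
    have e2 (i : Fin n) (c : ℝ) : x ∈ affineHyperplane (Pi.single i 1) c ↔ x i = c := by
      rw [mem_affineHyperplane]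
      simp [Pi.single_apply]
    constructor
    · intro h
      exact ⟨fun i j hij hx => h _ (.inl ⟨i, j, hij, rfl⟩) ((e1 i j).2 hx),
        fun i => ⟨fun hx => h _ (.inr ⟨i, .inl rfl⟩) ((e2 i _).2 hx),
          fun hx => h _ (.inr ⟨i, .inr rfl⟩) ((e2 i _).2 hx)⟩⟩
    · rintro ⟨ha, hb⟩ H (⟨i, j, hij, rfl⟩ | ⟨i, rfl | rfl⟩) hx
      · exact ha i j hij ((e1 i j).1 hx)
      · exact (hb i).1 ((e2 i _).1 hx)
      · exact (hb i).2 ((e2 i _).1 hx)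
  rw [Finset.mem_filter, hH, mem_nonopposingTuples, Fintype.mem_piFinset]
  constructor
  · rintro ⟨ha, hb, hc⟩
    exact ⟨fun i => ((Finset.mem_insert.1 (ha i)).resolve_left (hc i).2 |>
      Finset.mem_insert.1).resolve_left (hc i).1, hb⟩
  · rintro ⟨ha, hb⟩
    refine ⟨fun i => Finset.mem_insert_of_mem (Finset.mem_insert_of_mem (ha i)), hb, fun i => ?_⟩
    rcases Finset.mem_insert.1 (ha i) with h | h
    · rw [h]; norm_num
    · exact ⟨fun h' => h2 (h' ▸ h), fun h' => h1 (h' ▸ h)⟩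

/-- The grid used has side `{k / 2 | |k| ≤ m}`, which has `2 * m + 1` elements. For `m = 0` it would
lack `1 / 2` and `-1 / 2`. -/
theorem eval_charPoly_boxedThreshold (n : ℕ) {m : ℕ} (hm : 1 ≤ m) :
    (boxedThreshold n).charPoly.eval (2 * m + 1 : ℤ) =
      ∑ k ∈ Finset.range (n + 1), ((Nat.stirlingSecond n k : ℤ) +
        n * (Nat.stirlingSecond (n - 1) k : ℤ)) *
        ∏ i ∈ Finset.range k, ((2 * m - 2 : ℤ) - 2 * i) := by
  classical
  have h1 := half_notMem_halfIntegers m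
  have h2 := neg_half_notMem_halfIntegers m
  have h0 := zero_notMem_halfIntegers m
  have hneg := neg_mem_halfIntegers m
  have hcard := card_halfIntegers hm
  generalize halfIntegers m = Q at h1 h2 h0 hneg hcard
  set R : Finset ℝ := insert (1 / 2) (insert (-1 / 2) (insert 0 Q)) with hR
  have hRcard : (R.card : ℤ) = 2 * m + 1 := by
    rw [hR, Finset.card_insert_of_notMem, Finset.card_insert_of_notMem,
      Finset.card_insert_of_notMem h0]
    · push_cast; rw [hcard]; ring
    · rw [Finset.mem_insert, not_or]; exact ⟨by norm_num, h2⟩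
    · rw [Finset.mem_insert, Finset.mem_insert, not_or, not_or]
      exact ⟨by norm_num, by norm_num, h1⟩
  have hRneg : ∀ a ∈ R, -a ∈ R := by
    intro a ha
    simp only [hR, Finset.mem_insert] at ha ⊢
    rcases ha with rfl | rfl | rfl | ha
    · right; left; norm_num
    · left; norm_num
    · right; right; left; norm_num
    · exact .inr (.inr (.inr (hneg a ha)))
  rw [(boxedThreshold n).eval_charPoly_of_card (Fintype.piFinset fun _ => R), hR,
    filter_piFinset_boxedThreshold h1 h2, ← hcard]
  · have := sum_nonopposingTuples_insert_zero h0 hneg n fun _ => 1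
    simpa using this
  · rintro ⟨F, hF, S, hS, rfl⟩
    obtain ⟨I, hI⟩ := IsSignedGraph.exists_of_subset hS hF
    have := hI.card_filter_mem (Q := R) (by simp [hR]) (by simp [hR]) hRneg
    rw [← hRcard]
    exact_mod_cast this

theorem eval_prod_X_sub_odd (k : ℕ) (t : ℤ) :
    (∏ i ∈ Finset.Icc 1 k, (X - C (2 * (i : ℤ) + 1))).eval (2 * t + 1) =
      ∏ i ∈ Finset.range k, ((2 * t - 2) - 2 * (i : ℤ)) := by
  induction k with
  | zero => simp
  | succ k ih =>
    rw [Finset.prod_Icc_succ_top (by omega), eval_mul, ih, Finset.prod_range_succ]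
    congr 1
    simp only [eval_sub, eval_X, eval_C]
    push_cast
    ring

theorem charPoly_boxedThreshold (n : ℕ) :
    (boxedThreshold n).charPoly =
      ∑ k ∈ Finset.range (n + 1), C ((Nat.stirlingSecond n k : ℤ) +
        n * (Nat.stirlingSecond (n - 1) k : ℤ)) *
        ∏ i ∈ Finset.Icc 1 k, (X - C (2 * (i : ℤ) + 1)) := by
  refine eq_of_infinite_eval_eq _ _ ?_
  refine (Set.infinite_range_of_injective (f := fun m : ℕ => (2 * (m + 1 : ℕ) + 1 : ℤ))
    fun a b h => by simpa using h).mono ?_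
  rintro _ ⟨m, rfl⟩
  simp only [Set.mem_ofPred_eq]
  rw [eval_charPoly_boxedThreshold n (Nat.le_add_left 1 m), eval_finsetSum]
  simp only [eval_mul, eval_C, eval_prod_X_sub_odd]

theorem bCoeff_eq_zero_of_lt {k j : ℕ} (h : k < j) : bCoeff k j = 0 := by
  refine coeff_eq_zero_of_natDegree_lt ?_
  rwa [natDegree_prod_of_monic _ _ fun i _ => monic_X_sub_C _, Finset.sum_congr rfl
    fun i _ => natDegree_X_sub_C _, Finset.sum_const, Nat.card_Icc, smul_eq_mul, mul_one,
    Nat.add_sub_cancel]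

theorem corollary2p6 (n j : ℕ) :
    (boxedThreshold n).charPoly.coeff j =
      ∑ k ∈ Finset.Icc j n,
        ((Nat.stirlingSecond n k : ℤ) + (n : ℤ) * (Nat.stirlingSecond (n - 1) k : ℤ)) *
          bCoeff k j := by
  rw [charPoly_boxedThreshold, finsetSum_coeff]
  simp only [coeff_C_mul]
  refine (Finset.sum_subset (fun k hk => ?_) fun k hk hk' => ?_).symm
  · rw [Finset.mem_Icc] at hk
    exact Finset.mem_range.2 (by omega)
  · rw [Finset.mem_range] at hk
    rw [Finset.mem_Icc] at hk'
    exact mul_eq_zero_of_right _ (bCoeff_eq_zero_of_lt (by omega))
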